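/- Let $L/K$ be a finite separable field extension, let $E$ be the normal closure of $L/K$ (so $K\subseteq L\subseteq E$), and suppose that $L/K$ admits a Hopf-Galois structure, that is: there are a cocommutative $K$-Hopf algebra $H$ with comultiplication $h\mapsto\sum_{(h)}h_{(1)}\otimes h_{(2)}$ and counit $\varepsilon$, and an action of the algebra $H$ on $L$ by $K$-linear endomorphisms, such that $h\cdot(xy)=\sum_{(h)}(h_{(1)}\cdot x)(h_{(2)}\cdot y)$ and $h\cdot k=\varepsilon(h)k$ for all $h\in H$, $x,y\in L$, $k\in K$, and such that the $K$-linear map $L\otimes_K H\to\mathrm{End}_K(L)$, $x\otimes h\mapsto\bigl(y\mapsto x(h\cdot y)\bigr)$, is bijective. Let $G$ be a group acting faithfully and transitively on a finite set $X$ whose cardinality $n=|X|$ is squarefree, and suppose that $L/K$ realises this permutation group, that is, there are a point $x\in X$ and an isomorphism $\theta\colon G\to\mathrm{Gal}(E/K)$ which carries the stabiliser $G_x$ onto $\mathrm{Gal}(E/L)$. Then $G$ has derived length at most $4$, i.e. the fourth term $G^{(4)}$ of its derived series ($G^{(0)}=G$, $G^{(i+1)}=[G^{(i)},G^{(i)}]$)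 is trivial. In particular, $G$ is soluble. -/

import Mathlib

open scoped TensorProduct

/-- The `K`-linear map `L ⊗ H → End_K(L)` with `x ⊗ h ↦ (y ↦ x * (h · y))`, where `h · y = ρ h y`. -/
noncomputable def hopfGaloisMap {K L H : Type*} [Field K] [Field L] [Algebra K L]
    [Ring H] [Algebra K H] (ρ : H →ₐ[K] Module.End K L) :
    L ⊗[K] H →ₗ[K] Module.End K L :=
  TensorProduct.lift
    ((LinearMap.mul K (Module.End K L)).compl₁₂ (Algebra.lmul K L).toLinearMap ρ.toLinearMap)

theorem hopfGaloisMap_tmul {K L H : Type*} [Field K] [Field L] [Algebra K L]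
    [Ring H] [Algebra K H] (ρ : H →ₐ[K] Module.End K L) (x : L) (h : H) (y : L) :
    hopfGaloisMap ρ (x ⊗ₜ[K] h) y = x * ρ h y := rfl

/-- A Hopf-Galois structure on `L/K` with underlying cocommutative `K`-Hopf algebra `H`: an action
of `H` on `L` by `K`-linear endomorphisms which makes `L` an `H`-module algebra and for which
`L ⊗ H → End_K(L)` is bijective. -/
structure HopfGaloisStructure (K L H : Type*) [Field K] [Field L] [Algebra K L]
    [Ring H] [HopfAlgebra K H] [Coalgebra.IsCocomm K H] where
  /-- The action `h · y = act h y` of `H` on `L`. -/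
  act : H →ₐ[K] Module.End K L
  /-- `h · (x * y) = ∑ (h₁ · x) * (h₂ · y)`, where `comul h = ∑ h₁ ⊗ h₂`. -/
  act_mul : ∀ (h : H) (x y : L),
    act h (x * y) = LinearMap.mul' K L
      (TensorProduct.map (act.toLinearMap.flip x) (act.toLinearMap.flip y)
        (Coalgebra.comul (R := K) h))
  /-- `h · k = ε(h) k` for `k` in the ground field. -/
  act_algebraMap : ∀ (h : H) (k : K),
    act h (algebraMap K L k) = algebraMap K L (Coalgebra.counit (R := K) h * k)
  bijective : Function.Bijective (hopfGaloisMap act)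

/-- The extension `L/K`, with normal closure `E/K`, realises the (transitive) permutation group `G`
on `X`: there is an isomorphism `G ≃ Gal(E/K)` carrying a point stabiliser onto `Gal(E/L)`. -/
def RealisesPermGroup (K L E G X : Type*) [Field K] [Field L] [Field E]
    [Algebra K L] [Algebra K E] [Algebra L E] [IsScalarTower K L E]
    [Group G] [MulAction G X] : Prop :=
  ∃ (x : X) (θ : G ≃* (E ≃ₐ[K] E)),
    (MulAction.stabilizer G x).map θ.toMonoidHom =
      (IsScalarTower.toAlgHom K L E).fieldRange.fixingSubgroup

/-! After Greither and Pareigis. Each embedding `σ : L → E` gives an `E`-linear isomorphism from `E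
⊗ H` to `Hom_K(L, E)`. The elements sent to algebra homomorphisms do not depend on `σ`: they form a
group `N` acting simply transitively on the embeddings, so `|N| = [L : K] = |X|` is squarefree.
`Gal(E/K)` acts on `N` by automorphisms, compatibly with its action on embeddings.

For `|N|` squarefree, `N'` and `N/N'` are cyclic, which makes both `N` and `Aut N` metabelian. Hence
`G''` acts trivially on `N`, so it commutes with a regular action of `N` and embeds into `N`. Thus
`G''` is metabelian and `G⁽⁴⁾ = 1`. -/

/-- Endomorphisms of a cyclic group commute. -/
theorem IsCyclic.monoidHom_apply_comm {A : Type*} [Group A] [IsCyclic A] (f g : A →* A) (a : A) :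
    f (g a) = g (f a) := by
  obtain ⟨m, hm⟩ := f.map_cyclic
  rw [hm, hm, map_zpow]

/-! ### Groups of squarefree order and their automorphisms -/

/-- The automorphisms of `N` that act trivially on `N'` and on `N / N'`. -/
def commutatorStabilizer (N : Type*) [Group N] : Subgroup (MulAut N) where
  carrier := {α | (∀ a ∈ commutator N, α a = a) ∧
    ∀ x, Abelianization.of (α x) = Abelianization.of x}
  one_mem' := by simp
  mul_mem' := by
    rintro α β ⟨h₁, h₂⟩ ⟨k₁, k₂⟩
    exact ⟨fun a ha => by rw [MulAut.mul_apply, k₁ a ha, h₁ a ha],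
      fun x => by rw [MulAut.mul_apply, h₂, k₂]⟩
  inv_mem' := by
    rintro α ⟨h₁, h₂⟩
    refine ⟨fun a ha => ?_, fun x => ?_⟩
    · rw [MulAut.inv_apply, MulEquiv.symm_apply_eq, h₁ a ha]
    · rw [← h₂, MulAut.apply_inv_self]

theorem commutator_mulAut_le_commutatorStabilizer (N : Type*) [Group N]
    [IsCyclic (commutator N)] [IsCyclic (Abelianization N)] :
    commutator (MulAut N) ≤ commutatorStabilizer N := by
  have key : ∀ α : MulAut N, ∀ a ∈ commutator N, α a ∈ commutator N := fun α a ha => by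
    have h := Subgroup.mem_map_of_mem α.toMonoidHom ha
    rw [(Subgroup.characteristic_iff_map_eq.mp (inferInstance : (commutator N).Characteristic) α)]
      at h
    exact h
  rw [commutator_def, Subgroup.commutator_le]
  intro α _ β _
  refine ⟨fun a ha => ?_, fun x => ?_⟩
  · let r : MulAut N → (commutator N →* commutator N) := fun γ =>
      (γ.toMonoidHom.comp (commutator N).subtype).codRestrict _ fun a => key γ a a.2
    -- Evaluating `αβ = βα` at `α⁻¹β⁻¹a` gives `⁅α, β⁆ a = a`.
    have hc := congrArg Subtype.val (IsCyclic.monoidHom_apply_comm (r α) (r β)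
      ⟨α⁻¹ (β⁻¹ a), key _ _ (key _ _ ha)⟩)
    change α (β (α⁻¹ (β⁻¹ a))) = β (α (α⁻¹ (β⁻¹ a))) at hc
    rwa [MulAut.apply_inv_self, MulAut.apply_inv_self] at hc
  · have hc := IsCyclic.monoidHom_apply_comm (Abelianization.map α.toMonoidHom)
      (Abelianization.map β.toMonoidHom) (Abelianization.of (α⁻¹ (β⁻¹ x)))
    simp only [Abelianization.map_of] at hc
    change Abelianization.of (α (β (α⁻¹ (β⁻¹ x)))) =
      Abelianization.of (β (α (α⁻¹ (β⁻¹ x)))) at hc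
    rwa [MulAut.apply_inv_self, MulAut.apply_inv_self] at hc

/-- Write `α x = x * d x` with `d x ∈ N'`, and likewise `β x = x * d' x`. Both fix `N'` pointwise,
so `α (β x) = x * d x * d' x`, which is symmetric because `N'` is abelian. -/
theorem commute_of_mem_commutatorStabilizer {N : Type*} [Group N] [IsCyclic (commutator N)]
    {α β : MulAut N} (hα : α ∈ commutatorStabilizer N) (hβ : β ∈ commutatorStabilizer N) :
    α * β = β * α := by
  have key : ∀ γ ∈ commutatorStabilizer N, ∀ x, x⁻¹ * γ x ∈ commutator N := fun γ hγ x => by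
    rw [← Abelianization.ker_of, MonoidHom.mem_ker, map_mul, map_inv, hγ.2, inv_mul_cancel]
  ext x
  have h₁ : α (β x) = x * (x⁻¹ * α x) * (x⁻¹ * β x) := by
    conv_lhs => rw [← mul_inv_cancel_left x (β x), map_mul, hα.1 _ (key β hβ x)]
    group
  have h₂ : β (α x) = x * (x⁻¹ * β x) * (x⁻¹ * α x) := by
    conv_lhs => rw [← mul_inv_cancel_left x (α x), map_mul, hβ.1 _ (key α hα x)]
    group
  let _ : CommGroup (commutator N) := IsCyclic.commGroup
  have h₃ := congrArg Subtype.val (mul_comm (⟨_, key α hα x⟩ : commutator N) ⟨_, key β hβ x⟩)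
  change x⁻¹ * α x * (x⁻¹ * β x) = x⁻¹ * β x * (x⁻¹ * α x) at h₃
  rw [MulAut.mul_apply, MulAut.mul_apply, h₁, h₂, mul_assoc, h₃, mul_assoc x]

theorem derivedSeries_two_eq_bot_of_commute {G : Type*} [Group G]
    (h : ∀ a ∈ commutator G, ∀ b ∈ commutator G, a * b = b * a) : derivedSeries G 2 = ⊥ := by
  rw [derivedSeries_succ, derivedSeries_one, eq_bot_iff, Subgroup.commutator_le]
  intro a ha b hb
  rw [Subgroup.mem_bot, commutatorElement_eq_one_iff_mul_comm, h a ha b hb]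

theorem derivedSeries_mulAut_two_of_squarefree {N : Type*} [Group N]
    (hN : Squarefree (Nat.card N)) : derivedSeries (MulAut N) 2 = ⊥ := by
  have : Finite N := Nat.finite_of_card_ne_zero hN.ne_zero
  have := IsZGroup.of_squarefree hN
  have := IsZGroup.isCyclic_commutator (G := N)
  exact derivedSeries_two_eq_bot_of_commute fun a ha b hb =>
    commute_of_mem_commutatorStabilizer (commutator_mulAut_le_commutatorStabilizer N ha)
      (commutator_mulAut_le_commutatorStabilizer N hb)

theorem derivedSeries_two_of_squarefree {N : Type*} [Group N]
    (hN : Squarefree (Nat.card N)) : derivedSeries N 2 = ⊥ := by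
  have : Finite N := Nat.finite_of_card_ne_zero hN.ne_zero
  have := IsZGroup.of_squarefree hN
  have := IsZGroup.isCyclic_commutator (G := N)
  let _ : CommGroup (commutator N) := IsCyclic.commGroup
  exact derivedSeries_two_eq_bot_of_commute fun a ha b hb =>
    congrArg Subtype.val (mul_comm (⟨a, ha⟩ : commutator N) ⟨b, hb⟩)

theorem derivedSeries_eq_bot_of_injective {G G' : Type*} [Group G] [Group G'] {f : G →* G'}
    (hf : Function.Injective f) {n : ℕ} (h : derivedSeries G' n = ⊥) : derivedSeries G n = ⊥ := by
  have := map_derivedSeries_le_derivedSeries f n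
  rwa [h, le_bot_iff, Subgroup.map_eq_bot_iff_of_injective _ hf] at this

theorem map_subtype_derivedSeries {G : Type*} [Group G] (m n : ℕ) :
    (derivedSeries (derivedSeries G m) n).map (derivedSeries G m).subtype =
      derivedSeries G (m + n) := by
  induction n with
  | zero => rw [derivedSeries_zero, ← MonoidHom.range_eq_map, Subgroup.range_subtype, add_zero]
  | succ n ih => rw [derivedSeries_succ, Subgroup.map_commutator, ih, ← add_assoc,
      derivedSeries_succ]

/-- If `G` acts on a group `N` of squarefree order such that the subgroups of `G` acting trivially
embed into `N`, then `G` has derived length at most four. -/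
theorem derivedSeries_four_of_squarefree {G N : Type*} [Group G] [Group N]
    (hN : Squarefree (Nat.card N)) (φ : G →* MulAut N)
    (h : ∀ D : Subgroup G, D ≤ φ.ker → ∃ c : D →* N, Function.Injective c) :
    derivedSeries G 4 = ⊥ := by
  obtain ⟨c, hc⟩ := h (derivedSeries G 2) <| by
    have := map_derivedSeries_le_derivedSeries φ 2
    rwa [derivedSeries_mulAut_two_of_squarefree hN, le_bot_iff, Subgroup.map_eq_bot_iff] at this
  rw [← map_subtype_derivedSeries 2 2,
    derivedSeries_eq_bot_of_injective hc (derivedSeries_two_of_squarefree hN), Subgroup.map_bot]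

/-! ### Evaluation maps after base change to `E` -/

section TensorEval

variable {K L E V M : Type*} [Field K] [Field L] [Field E] [Algebra K L] [Algebra K E]
  [AddCommGroup V] [Module K V] [AddCommGroup M] [Module K M]

/-- The `E`-linear map `E ⊗ V → Hom_K(M, E)`, `e ⊗ v ↦ (m ↦ e * σ (F v m))`. -/
noncomputable def tensorEval (F : V →ₗ[K] M →ₗ[K] L) (σ : L →ₐ[K] E) :
    E ⊗[K] V →ₗ[E] M →ₗ[K] E :=
  LinearMap.liftBaseChange E (LinearMap.compRight K σ.toLinearMap ∘ₗ F)

@[simp]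
theorem tensorEval_tmul (F : V →ₗ[K] M →ₗ[K] L) (σ : L →ₐ[K] E) (e : E) (v : V) (m : M) :
    tensorEval F σ (e ⊗ₜ v) m = e * σ (F v m) := by
  simp [tensorEval]

/-- The coordinate functionals of a `K`-basis of `M` span `Hom_K(M, E)` over `E`. -/
theorem tensorEval_surjective_of_basis {F : V →ₗ[K] M →ₗ[K] L} {σ : L →ₐ[K] E} {ι : Type*}
    [Finite ι] (b : Module.Basis ι K M)
    (h : ∀ i, ∃ u, tensorEval F σ u = Algebra.linearMap K E ∘ₗ b.coord i) :
    Function.Surjective (tensorEval F σ) := by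
  have := Fintype.ofFinite ι
  intro f
  choose u hu using h
  refine ⟨∑ i, f (b i) • u i, b.ext fun j => ?_⟩
  classical
  simp [hu, Finsupp.single_apply]

theorem tensorEval_injective_of_surjective [FiniteDimensional K V] [FiniteDimensional K M]
    {F : V →ₗ[K] M →ₗ[K] L} {σ : L →ₐ[K] E}
    (h : Module.finrank K V = Module.finrank K M) (hs : Function.Surjective (tensorEval F σ)) :
    Function.Injective (tensorEval F σ) := by
  refine (LinearMap.injective_iff_surjective_of_finrank_eq_finrank ?_).mpr hs
  rw [Module.finrank_baseChange, Module.finrank_linearMap, Module.finrank_self, mul_one, h]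

end TensorEval

/-! ### The isomorphism of `E ⊗ H` with `Hom_K(L, E)` -/

namespace HopfGaloisStructure

variable {K L H : Type*} [Field K] [Field L] [Algebra K L]
  [Ring H] [HopfAlgebra K H] [Coalgebra.IsCocomm K H] (S : HopfGaloisStructure K L H)
  {E : Type*} [Field E] [Algebra K E]

/-- The `E`-linear map `E ⊗ H → Hom_K(L, E)`, `e ⊗ h ↦ (y ↦ e * σ (h · y))`. -/
noncomputable def eval (σ : L →ₐ[K] E) : E ⊗[K] H →ₗ[E] L →ₗ[K] E :=
  tensorEval S.act.toLinearMap σ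

/-- The action of `H ⊗ H` on `L ⊗ L`, followed by multiplication. -/
noncomputable def actTensor : H ⊗[K] H →ₗ[K] L ⊗[K] L →ₗ[K] L :=
  LinearMap.compRight K (LinearMap.mul' K L) ∘ₗ
    TensorProduct.homTensorHomMap (RingHom.id K) L L L L ∘ₗ
      TensorProduct.map S.act.toLinearMap S.act.toLinearMap

theorem actTensor_apply_tmul (t : H ⊗[K] H) (x y : L) :
    S.actTensor t (x ⊗ₜ y) = LinearMap.mul' K L
      (TensorProduct.map (S.act.toLinearMap.flip x) (S.act.toLinearMap.flip y) t) := by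
  induction t with
  | zero => simp
  | add a b ha hb => simp only [map_add, LinearMap.add_apply, ha, hb]
  | tmul h k => simp [actTensor]

/-- The external product `(e ⊗ h, f ⊗ k) ↦ e f ⊗ (h ⊗ k)`. -/
noncomputable def externalMul (u v : E ⊗[K] H) : E ⊗[K] (H ⊗[K] H) :=
  Algebra.TensorProduct.map (AlgHom.id K E) Algebra.TensorProduct.includeLeft u *
    Algebra.TensorProduct.map (AlgHom.id K E) Algebra.TensorProduct.includeRight v

theorem tensorEval_externalMul (σ : L →ₐ[K] E) (u v : E ⊗[K] H) (x y : L) :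
    tensorEval S.actTensor σ (externalMul u v) (x ⊗ₜ y) = S.eval σ u x * S.eval σ v y := by
  unfold externalMul
  induction u with
  | zero => simp
  | add a b ha hb => simp only [map_add, LinearMap.add_apply, add_mul, ha, hb]
  | tmul e h =>
    induction v with
    | zero => simp
    | add a b ha hb => simp only [map_add, LinearMap.add_apply, mul_add, ha, hb]
    | tmul f k =>
      simp only [Algebra.TensorProduct.map_tmul, AlgHom.coe_id, id_eq,
        Algebra.TensorProduct.includeLeft_apply, Algebra.TensorProduct.includeRight_apply,
        Algebra.TensorProduct.tmul_mul_tmul, mul_one, one_mul, tensorEval_tmul, eval]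
      simp only [actTensor_apply_tmul, TensorProduct.map_tmul, LinearMap.mul'_apply,
        LinearMap.flip_apply, map_mul]
      ring

theorem tensorEval_comul (σ : L →ₐ[K] E) (u : E ⊗[K] H) (x y : L) :
    tensorEval S.actTensor σ ((Coalgebra.comul (R := K) (A := H)).baseChange E u) (x ⊗ₜ y) =
      S.eval σ u (x * y) := by
  induction u with
  | zero => simp
  | add a b ha hb => simp only [map_add, LinearMap.add_apply, ha, hb]
  | tmul e h =>
    rw [LinearMap.baseChange_tmul, tensorEval_tmul, actTensor_apply_tmul, ← S.act_mul]
    exact (tensorEval_tmul S.act.toLinearMap σ e h (x * y)).symm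

theorem eval_one_right (σ : L →ₐ[K] E) (u : E ⊗[K] H) :
    S.eval σ u 1 =
      LinearMap.liftBaseChange E (Algebra.linearMap K E ∘ₗ Coalgebra.counit (R := K) (A := H)) u := by
  induction u with
  | zero => simp
  | add a b ha hb => simp only [map_add, LinearMap.add_apply, ha, hb]
  | tmul e h =>
    have h1 := S.act_algebraMap h 1
    rw [map_one, mul_one] at h1
    simp [eval, h1]

theorem eval_map_apply (σ : L →ₐ[K] E) (t : L ⊗[K] H) (y : L) :
    S.eval σ (σ.toLinearMap.rTensor H t) y = σ (hopfGaloisMap S.act t y) := by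
  induction t with
  | zero => simp
  | add a b ha hb => simp only [map_add, LinearMap.add_apply, ha, hb]
  | tmul e h => simp [eval, hopfGaloisMap_tmul]

theorem eval_one (σ : L →ₐ[K] E) (y : L) : S.eval σ 1 y = σ y := by
  simp [eval, Algebra.TensorProduct.one_def]

theorem eval_mul_tmul (σ : L →ₐ[K] E) (u : E ⊗[K] H) (e : E) (h : H) (y : L) :
    S.eval σ (u * e ⊗ₜ h) y = e * S.eval σ u (S.act h y) := by
  induction u with
  | zero => simp
  | add a b ha hb => simp only [map_add, LinearMap.add_apply, add_mul, mul_add, ha, hb]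
  | tmul f k => simp [eval]; ring

/-- This makes translation of embeddings by grouplike elements a right action. -/
theorem eval_mul {σ τ : L →ₐ[K] E} {u : E ⊗[K] H} (hu : S.eval σ u = τ.toLinearMap)
    (v : E ⊗[K] H) : S.eval σ (u * v) = S.eval τ v := by
  ext y
  induction v with
  | zero => simp
  | add a b ha hb => simp only [map_add, LinearMap.add_apply, mul_add, ha, hb]
  | tmul e h => rw [eval_mul_tmul, hu]; simp [eval]

theorem eval_galois (γ : E ≃ₐ[K] E) (σ : L →ₐ[K] E) (u : E ⊗[K] H) (y : L) :
    S.eval ((γ : E →ₐ[K] E).comp σ)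
      (Algebra.TensorProduct.map (γ : E →ₐ[K] E) (AlgHom.id K H) u) y = γ (S.eval σ u y) := by
  induction u with
  | zero => simp
  | add a b ha hb => simp only [map_add, LinearMap.add_apply, ha, hb]
  | tmul e h => simp [eval]

section FiniteDimensional

variable [FiniteDimensional K L]

include S in
theorem finiteDimensional : FiniteDimensional K H := by
  have h₁ : FiniteDimensional K (L ⊗[K] H) :=
    Module.Finite.of_injective (hopfGaloisMap S.act) S.bijective.1
  exact Module.Finite.of_injective
    (Algebra.TensorProduct.includeRight : H →ₐ[K] L ⊗[K] H).toLinearMap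
    (Algebra.TensorProduct.includeRight_injective (algebraMap K L).injective)

include S in
theorem finrank_eq : Module.finrank K H = Module.finrank K L := by
  have h := (LinearEquiv.ofBijective _ S.bijective).finrank_eq
  rw [Module.finrank_tensorProduct, Module.finrank_linearMap] at h
  exact Nat.eq_of_mul_eq_mul_left Module.finrank_pos h

theorem eval_surjective (σ : L →ₐ[K] E) : Function.Surjective (S.eval σ) := by
  refine tensorEval_surjective_of_basis (Module.finBasis K L) fun i => ?_
  -- A coordinate functional, viewed as an endomorphism of `L`, comes from `L ⊗ H`; apply `σ` to the
  -- left factor.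
  obtain ⟨t, ht⟩ := S.bijective.2 (Algebra.linearMap K L ∘ₗ (Module.finBasis K L).coord i)
  refine ⟨σ.toLinearMap.rTensor H t, LinearMap.ext fun y => (S.eval_map_apply σ t y).trans ?_⟩
  simp [ht]

theorem eval_injective (σ : L →ₐ[K] E) : Function.Injective (S.eval σ) :=
  have := S.finiteDimensional
  tensorEval_injective_of_surjective S.finrank_eq (S.eval_surjective σ)

theorem tensorEval_actTensor_injective (σ : L →ₐ[K] E) :
    Function.Injective (tensorEval S.actTensor σ) := by
  have := S.finiteDimensional
  refine tensorEval_injective_of_surjective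
    (by rw [Module.finrank_tensorProduct, Module.finrank_tensorProduct, S.finrank_eq]) ?_
  let b := Module.finBasis K L
  choose u hu using fun i => S.eval_surjective σ (Algebra.linearMap K E ∘ₗ b.coord i)
  refine tensorEval_surjective_of_basis (b.tensorProduct b) fun ⟨i, j⟩ =>
    ⟨externalMul (u i) (u j), TensorProduct.ext' fun x y => ?_⟩
  rw [tensorEval_externalMul, hu, hu]
  simp [Module.Basis.tensorProduct_repr_tmul_apply, mul_comm]

/-- If `S.eval σ u` is an algebra homomorphism for one embedding `σ`, then it is one for all
embeddings, since `u` is then a grouplike element of `E ⊗ H`. -/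
theorem exists_eval_eq_of_exists {σ τ : L →ₐ[K] E} {u : E ⊗[K] H}
    (hu : S.eval σ u = τ.toLinearMap) (σ' : L →ₐ[K] E) :
    ∃ τ' : L →ₐ[K] E, S.eval σ' u = τ'.toLinearMap := by
  -- Both sides send `x ⊗ y` to `τ (x * y) = τ x * τ y`. The resulting identity no longer mentions
  -- `σ`.
  have h : (Coalgebra.comul (R := K) (A := H)).baseChange E u = externalMul u u := by
    refine S.tensorEval_actTensor_injective σ (TensorProduct.ext' fun x y => ?_)
    rw [tensorEval_comul, tensorEval_externalMul, hu]
    simp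
  refine ⟨AlgHom.ofLinearMap (S.eval σ' u) ?_ fun x y => ?_, rfl⟩
  · rw [eval_one_right, ← S.eval_one_right σ, hu]
    simp
  · rw [← tensorEval_comul, h, tensorEval_externalMul]

end FiniteDimensional

end HopfGaloisStructure

/-- Homomorphisms out of a normal closure of `L/K` are determined by their composites with the
embeddings of `L`. -/
theorem IsNormalClosure.algHom_ext {K L E F : Type*} [Field K] [Field L] [Field E] [Field F]
    [Algebra K L] [Algebra K E] [Algebra K F] [Algebra.IsAlgebraic K L] [IsNormalClosure K L E]
    {f g : E →ₐ[K] F} (h : ∀ τ : L →ₐ[K] E, f.comp τ = g.comp τ) : f = g := by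
  have htop := (Algebra.IsAlgebraic.isNormalClosure_iff.mp ‹IsNormalClosure K L E›).2
  -- The equalizer is a subfield containing the image of every embedding of `L`.
  have hle : IntermediateField.normalClosure K L E ≤
      (AlgHom.equalizer f g).toIntermediateField fun x hx => by
        rw [AlgHom.mem_equalizer] at hx ⊢
        rw [map_inv₀, map_inv₀, hx] := by
    rw [normalClosure_le_iff]
    rintro τ _ ⟨y, rfl⟩
    exact DFunLike.congr_fun (h τ) y
  rw [htop] at hle
  exact AlgHom.ext fun x => hle (IntermediateField.mem_top (x := x))

/-! ### The regular action of the grouplike elements -/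

namespace HopfGaloisStructure

variable {K L H : Type*} [Field K] [Field L] [Algebra K L]
  [Ring H] [HopfAlgebra K H] [Coalgebra.IsCocomm K H] (S : HopfGaloisStructure K L H)

section Grouplikes

variable (E : Type*) [Field E] [Algebra K E]

/-- The monoid of those `u` in `E ⊗ H` for which `S.eval σ u : L → E` is a homomorphism of
`K`-algebras for all `σ`. -/
def grouplikes : Submonoid (E ⊗[K] H) where
  carrier := {u | ∀ σ : L →ₐ[K] E, ∃ τ : L →ₐ[K] E, S.eval σ u = τ.toLinearMap}
  one_mem' σ := ⟨σ, LinearMap.ext (S.eval_one σ)⟩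
  mul_mem' := by
    intro u v hu hv σ
    obtain ⟨τ, hτ⟩ := hu σ
    rw [S.eval_mul hτ]
    exact hv τ

end Grouplikes

variable {E : Type*} [Field E] [Algebra K E]

/-- The right action of the grouplike elements on the embeddings of `L` into `E`. -/
noncomputable def translate (σ : L →ₐ[K] E) (u : S.grouplikes E) : L →ₐ[K] E :=
  (u.2 σ).choose

theorem eval_eq_translate (σ : L →ₐ[K] E) (u : S.grouplikes E) :
    S.eval σ u = (S.translate σ u).toLinearMap :=
  (u.2 σ).choose_spec

theorem translate_eq_iff {σ τ : L →ₐ[K] E} {u : S.grouplikes E} :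
    S.translate σ u = τ ↔ S.eval σ u = τ.toLinearMap := by
  rw [eval_eq_translate]
  exact AlgHom.toLinearMap_injective.eq_iff.symm

theorem translate_one (σ : L →ₐ[K] E) : S.translate σ 1 = σ :=
  S.translate_eq_iff.mpr (LinearMap.ext (S.eval_one σ))

theorem translate_mul (σ : L →ₐ[K] E) (u v : S.grouplikes E) :
    S.translate σ (u * v) = S.translate (S.translate σ u) v := by
  rw [translate_eq_iff, ← eval_eq_translate]
  exact S.eval_mul (S.eval_eq_translate σ u) v

theorem galois_mem_grouplikes (γ : E ≃ₐ[K] E) {u : E ⊗[K] H} (hu : u ∈ S.grouplikes E) :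
    Algebra.TensorProduct.map (γ : E →ₐ[K] E) (AlgHom.id K H) u ∈ S.grouplikes E := by
  intro σ
  have hσ : (γ : E →ₐ[K] E).comp ((γ.symm : E →ₐ[K] E).comp σ) = σ := by ext; simp
  obtain ⟨τ, hτ⟩ := hu ((γ.symm : E →ₐ[K] E).comp σ)
  refine ⟨(γ : E →ₐ[K] E).comp τ, LinearMap.ext fun y => ?_⟩
  have h := S.eval_galois γ ((γ.symm : E →ₐ[K] E).comp σ) u y
  rw [hσ, hτ] at h
  exact h

/-- The semilinear action of the Galois group on the grouplike elements. -/
noncomputable def galoisAction : (E ≃ₐ[K] E) →* MulAut (S.grouplikes E) :=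
  let T (γ : E ≃ₐ[K] E) : S.grouplikes E →* S.grouplikes E :=
    { toFun := fun u => ⟨_, S.galois_mem_grouplikes γ u.2⟩
      map_one' := Subtype.ext (map_one _)
      map_mul' := fun _ _ => Subtype.ext (map_mul _ _ _) }
  have hT : ∀ γ δ u, T γ (T δ u) = T (γ * δ) u := fun γ δ u => Subtype.ext <| by
    change Algebra.TensorProduct.map (γ : E →ₐ[K] E) (AlgHom.id K H)
      (Algebra.TensorProduct.map (δ : E →ₐ[K] E) (AlgHom.id K H) u.1) =
      Algebra.TensorProduct.map ((γ * δ : E ≃ₐ[K] E) : E →ₐ[K] E) (AlgHom.id K H) u.1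
    generalize u.1 = v
    induction v with
    | zero => simp
    | add a b ha hb => simp only [map_add, ha, hb]
    | tmul e h => simp
  have hT1 : ∀ u, T 1 u = u := fun u => Subtype.ext <| by
    change Algebra.TensorProduct.map ((1 : E ≃ₐ[K] E) : E →ₐ[K] E) (AlgHom.id K H) u.1 = u.1
    generalize u.1 = v
    induction v with
    | zero => simp
    | add a b ha hb => simp only [map_add, ha, hb]
    | tmul e h => simp
  { toFun := fun γ =>
      { T γ with
        invFun := T γ⁻¹
        left_inv := fun u => (hT _ _ u).trans (by rw [inv_mul_cancel, hT1])
        right_inv := fun u => (hT _ _ u).trans (by rw [mul_inv_cancel, hT1]) }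
    map_one' := MulEquiv.ext hT1
    map_mul' := fun γ δ => MulEquiv.ext fun u => (hT γ δ u).symm }

theorem comp_translate (γ : E ≃ₐ[K] E) (σ : L →ₐ[K] E) (u : S.grouplikes E) :
    (γ : E →ₐ[K] E).comp (S.translate σ u) =
      S.translate ((γ : E →ₐ[K] E).comp σ) (S.galoisAction γ u) := by
  refine (S.translate_eq_iff.mpr (LinearMap.ext fun y => ?_)).symm
  refine (S.eval_galois γ σ u y).trans ?_
  rw [eval_eq_translate]
  rfl

variable [FiniteDimensional K L]

theorem translate_bijective (σ : L →ₐ[K] E) : Function.Bijective (S.translate σ) := by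
  refine ⟨fun u v h => Subtype.ext (S.eval_injective σ ?_), fun τ => ?_⟩
  · rw [eval_eq_translate, eval_eq_translate, h]
  · obtain ⟨u, hu⟩ := S.eval_surjective σ τ.toLinearMap
    exact ⟨⟨u, fun σ' => S.exists_eval_eq_of_exists hu σ'⟩, S.translate_eq_iff.mpr hu⟩

/-- Transitivity and freeness give every element a right inverse, which suffices in a monoid. -/
theorem isUnit_grouplikes (σ : L →ₐ[K] E) (u : S.grouplikes E) : IsUnit u := by
  have hr : ∀ u : S.grouplikes E, ∃ v, u * v = 1 := fun u => by
    obtain ⟨v, hv⟩ := (S.translate_bijective (S.translate σ u)).2 σ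
    exact ⟨v, (S.translate_bijective σ).1 (by rw [translate_mul, hv, translate_one])⟩
  obtain ⟨v, hv⟩ := hr u
  obtain ⟨w, hw⟩ := hr v
  have huw : u = w := by rw [← mul_one u, ← hw, ← mul_assoc, hv, one_mul]
  exact ⟨⟨u, v, hv, huw ▸ hw⟩, rfl⟩

/-- A group of Galois automorphisms which acts trivially on the grouplike elements embeds into
them. -/
theorem exists_injective_of_le_ker [IsNormalClosure K L E] (σ : L →ₐ[K] E)
    {D : Subgroup (E ≃ₐ[K] E)} (hD : D ≤ S.galoisAction.ker) :
    ∃ c : D →* S.grouplikes E, Function.Injective c := by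
  have hγ : ∀ (γ : D) (τ : L →ₐ[K] E) (u : S.grouplikes E),
      ((γ : E ≃ₐ[K] E) : E →ₐ[K] E).comp (S.translate τ u) =
        S.translate (((γ : E ≃ₐ[K] E) : E →ₐ[K] E).comp τ) u := fun γ τ u => by
    rw [comp_translate, MonoidHom.mem_ker.mp (hD γ.2), MulAut.one_apply]
  -- `c γ` is the unique element translating `σ` to `γ ∘ σ`.
  choose c hc using fun γ : D =>
    (S.translate_bijective σ).2 (((γ : E ≃ₐ[K] E) : E →ₐ[K] E).comp σ)
  have hc1 : c 1 = 1 := (S.translate_bijective σ).1 (by rw [hc, translate_one]; rfl)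
  have hcm : ∀ γ δ, c (γ * δ) = c γ * c δ := fun γ δ => (S.translate_bijective σ).1 <| by
    rw [translate_mul, hc γ, ← hγ, hc, hc]
    rfl
  refine ⟨⟨⟨c, hc1⟩, hcm⟩, fun γ δ h => Subtype.ext (AlgEquiv.coe_toAlgHom_injective ?_)⟩
  replace h : c γ = c δ := h
  -- Every embedding is a translate of `σ`, and `γ`, `δ` commute with translation, so agreement at
  -- `σ` spreads to all embeddings.
  have hcomp : ∀ τ : L →ₐ[K] E, ((γ : E ≃ₐ[K] E) : E →ₐ[K] E).comp τ =
      ((δ : E ≃ₐ[K] E) : E →ₐ[K] E).comp τ := fun τ => by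
    obtain ⟨u, rfl⟩ := (S.translate_bijective σ).2 τ
    rw [hγ, hγ, ← hc, ← hc, h]
  exact IsNormalClosure.algHom_ext hcomp

end HopfGaloisStructure

/-! ### Galois closure and the main theorem -/

theorem isGalois_of_isNormalClosure (K L E : Type*) [Field K] [Field L] [Field E] [Algebra K L]
    [Algebra K E] [Algebra.IsSeparable K L] [IsNormalClosure K L E] : IsGalois K E := by
  have hN := IsNormalClosure.normal (F := K) (K := L) (L := E)
  have hs : Algebra.IsSeparable K (⨆ x : L, IntermediateField.adjoin K ((minpoly K x).rootSet E) :
      IntermediateField K E) := by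
    have : ∀ x : L, Algebra.IsSeparable K (IntermediateField.adjoin K ((minpoly K x).rootSet E)) :=
      fun x => (IntermediateField.isSeparable_adjoin_iff_isSeparable K E).mpr fun y hy =>
        (Algebra.IsSeparable.isSeparable K x).of_dvd
          (minpoly.dvd K y (Polynomial.mem_rootSet.mp hy).2)
    infer_instance
  rw [IsNormalClosure.adjoin_rootSet] at hs
  have : Algebra.IsSeparable K E :=
    ⟨fun x => IntermediateField.isSeparable_of_mem_isSeparable K E
      (L := ⊤) IntermediateField.mem_top⟩
  exact ⟨⟩

theorem theorem3p3 {G X K L E H : Type*}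
    -- a transitive permutation group `G` on the finite set `X`, of squarefree degree
    [Group G] [Finite X] [MulAction G X] [FaithfulSMul G X] [MulAction.IsPretransitive G X]
    (hn : Squarefree (Nat.card X))
    -- a finite separable extension `L/K` with normal closure `E/K`
    [Field K] [Field L] [Field E] [Algebra K L] [Algebra K E] [Algebra L E] [IsScalarTower K L E]
    [FiniteDimensional K L] [Algebra.IsSeparable K L] [IsNormalClosure K L E]
    (hG : RealisesPermGroup K L E G X)
    -- a Hopf-Galois structure on `L/K`
    [Ring H] [HopfAlgebra K H] [Coalgebra.IsCocomm K H] (S : HopfGaloisStructure K L H) :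
    derivedSeries G 4 = ⊥ ∧ Group.IsSolvable G := by
  obtain ⟨x, θ, hθ⟩ := hG
  have := isGalois_of_isNormalClosure K L E
  let σ := IsScalarTower.toAlgHom K L E
  -- Both equal `[L : K]`: the first counts embeddings, the second is the index of `G_x`, carried by
  -- `θ` to that of `Gal(E/L)`.
  have hcard : Nat.card (S.grouplikes E) = Nat.card X := by
    rw [Nat.card_eq_of_bijective _ (S.translate_bijective σ), Nat.card_eq_fintype_card,
      AlgHom.card_of_splits K L E (IsNormalClosure.splits (F := K) (K := L)),
      (AlgEquiv.ofInjectiveField σ).toLinearEquiv.finrank_eq,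
      ← MulAction.index_stabilizer_of_transitive G x, ← Subgroup.index_map_equiv _ θ]
    exact (IntermediateField.finrank_eq_fixingSubgroup_index E σ.fieldRange).trans
      (congrArg Subgroup.index hθ.symm)
  let _ : Group (S.grouplikes E) := groupOfIsUnit (S.isUnit_grouplikes σ)
  have h4 : derivedSeries (E ≃ₐ[K] E) 4 = ⊥ :=
    derivedSeries_four_of_squarefree (hcard ▸ hn) S.galoisAction
      fun D hD => S.exists_injective_of_le_ker σ hD
  have h := derivedSeries_eq_bot_of_injective (f := θ.toMonoidHom) θ.injective h4
  exact ⟨h, ⟨4, h⟩⟩
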